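/- Fix an integer $k$ and real constants $\alpha, p, r$ with $\alpha>\frac1k$, $0<p<1$, $k\ge\frac1{1-p}$ (so that $k\ge 2$) and $r\ge 0$. For each $n$ let $d=d(n)$, $q=q(n)$, $t=t(n)$ be nonnegative integers obtained from $n^{\alpha}$, $p\,d^{k}$ and $r\,n\ln n$, respectively, by rounding up or down in an arbitrary way: for all sufficiently large $n$, $$|d-n^{\alpha}|<1,\qquad |q-p\,d^{k}|<1,\qquad |t-r\,n\ln n|<1 .$$ A random instance of Model RB with these parameters is a constraint satisfaction problem on $n$ variables, each with the same domain of $d$ values, consisting of $t$ random constraints chosen independently (with repetition). Each random constraint is formed by choosing uniformly a set of $k$ distinct variables among the $n$ variables, and then choosing uniformly a set of exactly $q$ of the $d^{k}$ tuples of values of these $k$ variables, which are declared incompatible. An assignment of values to the $n$ variables satisfies a constraint if the tuple of values that it gives to the $k$ variables of the constraint is not incompatible; the instance is satisfiable if some assignment satisfies all $t$ constraints. Let $\Pr(\mathrm{Sat})$ be the probability that the random instance is satisfiable, and let $$r_{cr}=-\frac{\alpha}{\ln(1-p)} .$$ Then $$\lim_{n\to\infty}\Pr(\mathrm{Sat})=1\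 \text{ when } r<r_{cr},\qquad \lim_{n\to\infty}\Pr(\mathrm{Sat})=0\ \text{ when } r>r_{cr}.$$ -/

import Mathlib

open Filter Topology

namespace ModelRB

/-- A constraint scope: a set of `k` of the `n` variables. -/
abbrev Scope (n k : ℕ) : Type := {s : Finset (Fin n) // s.card = k}

/-- A set of exactly `q` incompatible tuples of values for the variables in `s`, every variable
having the domain `Fin d`. A tuple of values for the variables in `s` is a function `s → Fin d`. -/
abbrev Incompatible {n : ℕ} (d q : ℕ) (s : Finset (Fin n)) : Type :=
  {T : Finset (s → Fin d) // T.card = q}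

/-- A `k`-ary constraint on `n` variables with domain size `d` and exactly `q` incompatible
tuples: a scope together with its set of incompatible tuples. -/
abbrev Constraint (n k d q : ℕ) : Type := Σ s : Scope n k, Incompatible d q s.1

/-- The assignment `σ` satisfies the constraint `c`: the tuple of values which `σ` gives to the
variables in the scope of `c` is not one of the incompatible tuples of `c`. -/
def SatisfiedBy {n k d q : ℕ} (c : Constraint n k d q) (σ : Fin n → Fin d) : Prop :=
  (fun i : c.1.1 => σ i) ∉ c.2.1

/-- A CSP instance: a sequence of `t` constraints, repetitions allowed. -/
abbrev CSP (n k d q t : ℕ) : Type := Fin t → Constraint n k d q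

/-- An instance is satisfiable if some assignment satisfies all of its constraints. -/
def Satisfiable {n k d q t : ℕ} (φ : CSP n k d q t) : Prop :=
  ∃ σ : Fin n → Fin d, ∀ j, SatisfiedBy (φ j) σ

/-- The number of possible sets of incompatible tuples is the same for all scopes. So choosing a
scope uniformly, and then a set of `q` incompatible tuples uniformly, is the same as choosing a
constraint uniformly. -/
theorem card_incompatible {n k : ℕ} (d q : ℕ) (s : Scope n k) :
    Fintype.card (Incompatible d q s.1) = (d ^ k).choose q := by
  simp [Incompatible, s.2]

open scoped Classical in
/-- `Pr(Sat)`: the probability that a random instance is satisfiable. The `t` constraints are drawn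
independently (with repetition); each is formed by drawing uniformly a `k`-subset of the `n`
variables and then uniformly a set of `q` incompatible tuples. That is, all the instances in
`CSP n k d q t` are equally likely. -/
noncomputable def prSat (n k d q t : ℕ) : ℝ :=
  (Fintype.card {φ : CSP n k d q t // Satisfiable φ} : ℝ) / (Fintype.card (CSP n k d q t) : ℝ)

end ModelRB

namespace ModelRB

/-! Let N be the number of solutions, v = q/d^k → p and b = v/(1-v) → β = p/(1-p), so that 1+β =
1/(1-p). Then E N = d^n (1-v)^t = exp(n ln n (α + r ln(1-p) + o(1))), and r_cr is where this
exponent changes sign. Above it, Pr(Sat) ≤ E N → 0.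

Below it, Cauchy–Schwarz gives Pr(Sat) ≥ (E N)²/E N². Two assignments agreeing on S = xn variables
both satisfy a random constraint with probability at most (1-v)²(1 + b x^k)
(`card_satisfiedBy_pair_le`), so E N²/(E N)² is at most the average of (1 + b x^k)^t over all pairs.
It remains to bound this average by 1 + o(1) (`sum_agreement_le`, `agreement_term_bound`). Overlaps
x ≤ n^(-γ), with 1/k < γ < α, have weight 1 + o(1). Every other S contributes at most ρ^S with ρ =
O(n^(-δ)): the entropy factor C(n,S)/d^S ≤ (e/(xd))^S beats the weight. For small x this is because
x^k ≤ x₀x; for x bounded below it is because convexity gives ln(1+βx^k) ≤ x ln(1+β)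
(`log_one_add_mul_pow_le`), and r ln(1+β) < α below the threshold. -/

/-! ### Counting the constraints satisfied by one or two assignments -/

theorem card_finsets_avoiding {X : Type*} [Fintype X] [DecidableEq X] (q : ℕ) (B : Finset X) :
    (Finset.univ.filter fun T : {T : Finset X // T.card = q} => ∀ x ∈ B, x ∉ T.1).card
      = (Fintype.card X - B.card).choose q := by
  rw [← Finset.card_compl, ← Finset.card_powersetCard]
  refine Finset.card_bij (fun T _ => T.1) ?_ ?_ ?_
  · intro T hT
    simp only [Finset.mem_filter, Finset.mem_univ, true_and] at hT
    rw [Finset.mem_powersetCard]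
    refine ⟨fun x hx => ?_, T.2⟩
    rw [Finset.mem_compl]
    exact fun hB => hT x hB hx
  · intro T _ T' _ h
    exact Subtype.ext h
  · intro T hT
    rw [Finset.mem_powersetCard] at hT
    refine ⟨⟨T, hT.2⟩, ?_, rfl⟩
    simp only [Finset.mem_filter, Finset.mem_univ, true_and]
    intro x hx hxT
    exact (Finset.mem_compl.1 (hT.1 hxT)) hx

theorem card_scopes_subset {n k : ℕ} (A : Finset (Fin n)) :
    (Finset.univ.filter fun s : Scope n k => s.1 ⊆ A).card = A.card.choose k := by
  rw [← Finset.card_powersetCard]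
  refine Finset.card_bij (fun s _ => s.1) ?_ ?_ ?_
  · intro s hs
    simp only [Finset.mem_filter, Finset.mem_univ, true_and] at hs
    exact Finset.mem_powersetCard.2 ⟨hs, s.2⟩
  · intro s _ s' _ h
    exact Subtype.ext h
  · intro s hs
    rw [Finset.mem_powersetCard] at hs
    exact ⟨⟨s, hs.2⟩, by simpa using hs.1, rfl⟩

/-- Factor by factor, (S-i)/(n-i) ≤ S/n; hence a random k-set lies in a given S-set with probability
at most (S/n)^k. -/
theorem choose_mul_pow_le {S n : ℕ} (h : S ≤ n) (k : ℕ) :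
    S.choose k * n ^ k ≤ n.choose k * S ^ k := by
  have key : S.descFactorial k * n ^ k ≤ n.descFactorial k * S ^ k := by
    induction k with
    | zero => simp
    | succ k ih =>
      rw [Nat.descFactorial_succ, Nat.descFactorial_succ, pow_succ, pow_succ]
      have h1 : (S - k) * n ≤ (n - k) * S := by
        rcases le_total S k with hS | hS
        · simp [Nat.sub_eq_zero_of_le hS]
        · obtain ⟨a, rfl⟩ := Nat.exists_eq_add_of_le hS
          obtain ⟨b, rfl⟩ := Nat.exists_eq_add_of_le h
          have e : k + a + b - k = a + b := by omega
          rw [e, Nat.add_sub_cancel_left]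
          nlinarith [Nat.zero_le (b * k)]
      calc (S - k) * S.descFactorial k * (n ^ k * n)
          = (S.descFactorial k * n ^ k) * ((S - k) * n) := by ring
        _ ≤ (n.descFactorial k * S ^ k) * ((n - k) * S) := Nat.mul_le_mul ih h1
        _ = _ := by ring
  rw [Nat.descFactorial_eq_factorial_mul_choose, Nat.descFactorial_eq_factorial_mul_choose,
    mul_assoc, mul_assoc] at key
  exact Nat.le_of_mul_le_mul_left key (Nat.factorial_pos k)

theorem choose_pred {m q : ℕ} (hq : q < m) :
    ((m - 1).choose q : ℝ) = m.choose q * (1 - q / m) := by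
  obtain ⟨a, rfl⟩ : ∃ a, m = a + 1 := ⟨m - 1, by omega⟩
  have h := Nat.choose_mul_succ_eq a q
  have h' : (a.choose q : ℝ) * (a + 1 : ℕ) = (a + 1).choose q * ((a + 1 : ℕ) - q) := by
    rw [← Nat.cast_sub hq.le]
    exact_mod_cast h
  have : ((a + 1 : ℕ) : ℝ) ≠ 0 := by positivity
  rw [Nat.add_sub_cancel]
  field_simp
  linarith

/-- Drawing without replacement is negatively correlated: the exact ratio is (1-q/m)(1-q/(m-1)). -/
theorem choose_pred_pred_le {m q : ℕ} (hm : 2 ≤ m) (hq : q < m) :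
    ((m - 2).choose q : ℝ) ≤ m.choose q * (1 - q / m) ^ 2 := by
  have hu : (0 : ℝ) ≤ 1 - q / m := by
    have : (0 : ℝ) < m := by positivity
    rw [sub_nonneg, div_le_one this]
    exact_mod_cast hq.le
  rcases Nat.lt_or_ge q (m - 1) with h | h
  · have e : m - 2 = m - 1 - 1 := by omega
    rw [e, choose_pred h, choose_pred hq, sq, ← mul_assoc]
    have : (1 : ℝ) - q / (m - 1 : ℕ) ≤ 1 - q / m := by
      gcongr
      · exact_mod_cast (by omega : 0 < m - 1)
      · omega
    exact mul_le_mul_of_nonneg_left this (by positivity)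
  · rw [Nat.choose_eq_zero_of_lt (by omega), Nat.cast_zero]
    positivity

open scoped Classical in
-- The incompatible set has to avoid one tuple if the scope lies in the agreement set, and two
-- distinct tuples otherwise.
theorem card_satisfiedBy_pair {n k d q : ℕ} (σ τ : Fin n → Fin d) :
    (Finset.univ.filter fun c : Constraint n k d q => SatisfiedBy c σ ∧ SatisfiedBy c τ).card
      = ∑ s : Scope n k,
        (d ^ k - if s.1 ⊆ Finset.univ.filter (fun i => σ i = τ i) then 1 else 2).choose q := by
  have : (Finset.univ.filter fun c : Constraint n k d q => SatisfiedBy c σ ∧ SatisfiedBy c τ)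
      = Finset.univ.sigma fun s : Scope n k => Finset.univ.filter fun T : Incompatible d q s.1 =>
        ∀ x ∈ ({(fun i : s.1 => σ i), (fun i : s.1 => τ i)} : Finset (s.1 → Fin d)), x ∉ T.1 := by
    ext ⟨s, T⟩
    rw [Finset.mem_filter, Finset.mem_sigma, Finset.mem_filter]
    simp [SatisfiedBy]
  rw [this, Finset.card_sigma]
  refine Finset.sum_congr rfl fun s _ => ?_
  rw [card_finsets_avoiding]
  have hX : Fintype.card (s.1 → Fin d) = d ^ k := by simp [s.2]
  rw [hX]
  congr 2
  split_ifs with h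
  · rw [Finset.card_eq_one]
    refine ⟨fun i => σ i, ?_⟩
    have : (fun i : s.1 => τ i) = fun i : s.1 => σ i := by
      funext i
      simpa using (Finset.mem_filter.1 (h i.2)).2.symm
    simp [this]
  · apply Finset.card_pair
    intro e
    apply h
    intro i hi
    simpa using congrFun e ⟨i, hi⟩

theorem card_constraint (n k d q : ℕ) :
    Fintype.card (Constraint n k d q) = n.choose k * (d ^ k).choose q := by
  rw [Fintype.card_sigma, Finset.sum_congr rfl fun s _ => card_incompatible d q s]
  simp [Scope]

open scoped Classical in
theorem card_satisfiedBy {n k d q : ℕ} (hq : q < d ^ k) (σ : Fin n → Fin d) :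
    ((Finset.univ.filter fun c : Constraint n k d q => SatisfiedBy c σ).card : ℝ)
      = Fintype.card (Constraint n k d q) * (1 - q / (d ^ k : ℕ)) := by
  have h := card_satisfiedBy_pair (k := k) (q := q) σ σ
  simp only [and_self] at h
  rw [h, card_constraint]
  simp only [Finset.filter_true, Finset.subset_univ, if_true, Finset.sum_const, Finset.card_univ,
    smul_eq_mul, Nat.cast_mul]
  rw [choose_pred hq]
  simp [Scope, mul_assoc]

open scoped Classical in
-- A scope inside the agreement set has conditional probability 1-v = (1-v)²(1 + v/(1-v)), any other
-- at most (1-v)²; the former has probability at most (S/n)^k.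
theorem card_satisfiedBy_pair_le {n k d q : ℕ} (hn0 : 0 < n) (hq : q < d ^ k)
    (σ τ : Fin n → Fin d) :
    ((Finset.univ.filter fun c : Constraint n k d q => SatisfiedBy c σ ∧ SatisfiedBy c τ).card : ℝ)
      ≤ Fintype.card (Constraint n k d q) * (1 - q / (d ^ k : ℕ)) ^ 2 *
        (1 + (q / (d ^ k : ℕ)) / (1 - q / (d ^ k : ℕ)) *
          (((Finset.univ.filter fun i => σ i = τ i).card : ℝ) / n) ^ k) := by
  set A := Finset.univ.filter fun i => σ i = τ i with hA
  set v : ℝ := q / (d ^ k : ℕ) with hv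
  have hm0 : (0 : ℝ) < (d ^ k : ℕ) := by exact_mod_cast (Nat.zero_le q).trans_lt hq
  have hv0 : 0 ≤ v := by positivity
  have hv1 : 0 < 1 - v := by
    rw [sub_pos, hv, div_lt_one hm0]
    exact_mod_cast hq
  rw [card_satisfiedBy_pair, card_constraint]
  have step : ∀ s : Scope n k,
      (((d ^ k - if s.1 ⊆ A then 1 else 2).choose q : ℕ) : ℝ)
        ≤ (d ^ k).choose q * (1 - v) ^ 2 +
          (if s.1 ⊆ A then (d ^ k).choose q * ((1 - v) * v) else 0) := by
    intro s
    split_ifs with h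
    · rw [choose_pred hq, ← hv]
      apply le_of_eq
      ring
    · rw [add_zero]
      refine choose_pred_pred_le ?_ hq
      -- Two distinct tuples exist on this scope, so d^k ≥ 2.
      obtain ⟨i, hi, hiA⟩ := Finset.not_subset.1 h
      have hne : (fun j : s.1 => σ j) ≠ fun j : s.1 => τ j := fun e =>
        hiA (by simpa [hA] using congrFun e ⟨i, hi⟩)
      have := Fintype.one_lt_card_iff.2 ⟨_, _, hne⟩
      exact Nat.succ_le_of_lt (by simpa [s.2] using this)
  have hchoose : ((A.card.choose k : ℕ) : ℝ) ≤ n.choose k * ((A.card : ℝ) / n) ^ k := by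
    have hAn : A.card ≤ n := by simpa using Finset.card_le_univ A
    have := choose_mul_pow_le hAn k
    have hn' : (0 : ℝ) < (n : ℝ) ^ k := by positivity
    rw [div_pow, ← mul_div_assoc, le_div_iff₀ hn']
    exact_mod_cast this
  push_cast only [Nat.cast_sum, Nat.cast_mul]
  calc _ ≤ ∑ s : Scope n k, ((d ^ k).choose q * (1 - v) ^ 2 +
          (if s.1 ⊆ A then (d ^ k).choose q * ((1 - v) * v) else 0)) :=
        Finset.sum_le_sum fun s _ => step s
    _ = n.choose k * ((d ^ k).choose q * (1 - v) ^ 2) +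
          A.card.choose k * ((d ^ k).choose q * ((1 - v) * v)) := by
        rw [Finset.sum_add_distrib, ← Finset.sum_filter, Finset.sum_const, Finset.sum_const,
          card_scopes_subset]
        simp [Scope]
    _ ≤ n.choose k * ((d ^ k).choose q * (1 - v) ^ 2) +
          n.choose k * ((A.card : ℝ) / n) ^ k * ((d ^ k).choose q * ((1 - v) * v)) := by
        gcongr
    _ = _ := by
        field_simp

/-! ### First and second moments of the number of solutions -/

theorem card_csp_forall {n k d q t : ℕ} (P : Constraint n k d q → Prop) [DecidablePred P]
    [DecidablePred fun φ : CSP n k d q t => ∀ j, P (φ j)] :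
    (Finset.univ.filter fun φ : CSP n k d q t => ∀ j, P (φ j)).card
      = (Finset.univ.filter P).card ^ t := by
  have : (Finset.univ.filter fun φ : CSP n k d q t => ∀ j, P (φ j))
      = Fintype.piFinset fun _ : Fin t => Finset.univ.filter P := by
    ext φ
    simp
  rw [this]
  simp

theorem card_csp (n k d q t : ℕ) :
    Fintype.card (CSP n k d q t) = Fintype.card (Constraint n k d q) ^ t := by
  simp [CSP]

theorem card_constraint_pos {n k d q : ℕ} (hn : k ≤ n) (hq : q < d ^ k) :
    0 < Fintype.card (Constraint n k d q) := by
  rw [card_constraint]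
  exact Nat.mul_pos (Nat.choose_pos hn) (Nat.choose_pos hq.le)

theorem prSat_nonneg (n k d q t : ℕ) : 0 ≤ prSat n k d q t := by
  unfold prSat
  positivity

theorem prSat_le_one (n k d q t : ℕ) : prSat n k d q t ≤ 1 := by
  classical
  unfold prSat
  refine div_le_one_of_le₀ ?_ (by positivity)
  exact_mod_cast Fintype.card_subtype_le _

open scoped Classical in
/-- The number of assignments satisfying an instance. -/
noncomputable def numSolutions {n k d q t : ℕ} (φ : CSP n k d q t) : ℕ :=
  (Finset.univ.filter fun σ : Fin n → Fin d => ∀ j, SatisfiedBy (φ j) σ).card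

theorem satisfiable_iff_numSolutions {n k d q t : ℕ} (φ : CSP n k d q t) :
    Satisfiable φ ↔ 0 < numSolutions φ := by
  classical
  simp [Satisfiable, numSolutions, Finset.card_pos, Finset.Nonempty]

open scoped Classical in
theorem prSat_eq (n k d q t : ℕ) : prSat n k d q t =
    ((Finset.univ.filter fun φ : CSP n k d q t => Satisfiable φ).card : ℝ)
      / Fintype.card (CSP n k d q t) := by
  unfold prSat
  rw [Fintype.card_subtype]

theorem sum_numSolutions {n k d q t : ℕ} (hq : q < d ^ k) :
    ∑ φ : CSP n k d q t, (numSolutions φ : ℝ)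
      = d ^ n * (Fintype.card (CSP n k d q t) * (1 - q / (d ^ k : ℕ)) ^ t) := by
  classical
  have h1 : ∀ φ : CSP n k d q t, (numSolutions φ : ℝ)
      = ∑ σ : Fin n → Fin d, if (∀ j, SatisfiedBy (φ j) σ) then (1 : ℝ) else 0 := by
    intro φ
    simp [numSolutions]
  simp_rw [h1]
  rw [Finset.sum_comm]
  have h2 : ∀ σ : Fin n → Fin d,
      (∑ φ : CSP n k d q t, if (∀ j, SatisfiedBy (φ j) σ) then (1 : ℝ) else 0)
        = Fintype.card (CSP n k d q t) * (1 - q / (d ^ k : ℕ)) ^ t := by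
    intro σ
    rw [Finset.sum_boole, card_csp_forall (fun c => SatisfiedBy c σ), Nat.cast_pow,
      card_satisfiedBy hq, card_csp, Nat.cast_pow (Fintype.card (Constraint n k d q)), mul_pow]
  rw [Finset.sum_congr rfl fun σ _ => h2 σ]
  simp

theorem prSat_le_first_moment {n k d q t : ℕ} (hn : k ≤ n) (hq : q < d ^ k) :
    prSat n k d q t ≤ d ^ n * (1 - q / (d ^ k : ℕ)) ^ t := by
  classical
  have hM : (0 : ℝ) < Fintype.card (CSP n k d q t) := by
    rw [card_csp]
    exact_mod_cast pow_pos (card_constraint_pos hn hq) t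
  rw [prSat_eq, div_le_iff₀ hM]
  calc _ = ∑ φ : CSP n k d q t, if Satisfiable φ then (1 : ℝ) else 0 := by simp
    _ ≤ ∑ φ : CSP n k d q t, (numSolutions φ : ℝ) := by
        refine Finset.sum_le_sum fun φ _ => ?_
        split_ifs with h
        · exact_mod_cast (satisfiable_iff_numSolutions φ).1 h
        · positivity
    _ = _ := by
        rw [sum_numSolutions hq]
        ring

theorem sum_numSolutions_sq_le {n k d q t : ℕ} (hn0 : 0 < n) (hq : q < d ^ k) :
    ∑ φ : CSP n k d q t, (numSolutions φ : ℝ) ^ 2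
      ≤ Fintype.card (CSP n k d q t) * (1 - q / (d ^ k : ℕ)) ^ (2 * t) *
        ∑ σ : Fin n → Fin d, ∑ τ : Fin n → Fin d,
          (1 + (q / (d ^ k : ℕ)) / (1 - q / (d ^ k : ℕ)) *
            (((Finset.univ.filter fun i => σ i = τ i).card : ℝ) / n) ^ k) ^ t := by
  classical
  have h1 : ∀ φ : CSP n k d q t, (numSolutions φ : ℝ) ^ 2
      = ∑ σ : Fin n → Fin d, ∑ τ : Fin n → Fin d,
        if (∀ j, SatisfiedBy (φ j) σ ∧ SatisfiedBy (φ j) τ) then (1 : ℝ) else 0 := by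
    intro φ
    have : (numSolutions φ : ℝ)
      = ∑ σ : Fin n → Fin d, if (∀ j, SatisfiedBy (φ j) σ) then (1 : ℝ) else 0 := by
      simp [numSolutions]
    rw [this, sq, Finset.sum_mul_sum]
    refine Finset.sum_congr rfl fun σ _ => Finset.sum_congr rfl fun τ _ => ?_
    rw [ite_zero_mul_ite_zero, mul_one]
    simp only [forall_and]
  simp_rw [h1]
  rw [Finset.sum_comm, Finset.mul_sum]
  refine Finset.sum_le_sum fun σ _ => ?_
  rw [Finset.sum_comm, Finset.mul_sum]
  refine Finset.sum_le_sum fun τ _ => ?_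
  rw [Finset.sum_boole, card_csp_forall (fun c => SatisfiedBy c σ ∧ SatisfiedBy c τ), Nat.cast_pow,
    card_csp, Nat.cast_pow, pow_mul, ← mul_pow, ← mul_pow]
  exact pow_le_pow_left₀ (by positivity) (card_satisfiedBy_pair_le hn0 hq σ τ) t

/-- Cauchy–Schwarz on the satisfiable instances, the only ones contributing to either moment; B
bounds E N²/(E N)². -/
theorem second_moment {n k d q t : ℕ} (hq : q < d ^ k) (hn : k ≤ n) (hd : 0 < d) (B : ℝ)
    (hB : ∑ φ : CSP n k d q t, (numSolutions φ : ℝ) ^ 2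
      ≤ Fintype.card (CSP n k d q t) * (1 - q / (d ^ k : ℕ)) ^ (2 * t) * (d ^ n * (d ^ n * B))) :
    1 ≤ prSat n k d q t * B := by
  classical
  have hM : (0 : ℝ) < Fintype.card (CSP n k d q t) := by
    rw [card_csp]
    exact_mod_cast pow_pos (card_constraint_pos hn hq) t
  have hu : (0 : ℝ) < 1 - q / (d ^ k : ℕ) := by
    have : (0 : ℝ) < (d ^ k : ℕ) := by positivity
    rw [sub_pos, div_lt_one this]
    exact_mod_cast hq
  set M : ℝ := (Fintype.card (CSP n k d q t) : ℝ)
  set u : ℝ := 1 - q / (d ^ k : ℕ)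
  set Z : Finset (CSP n k d q t) := Finset.univ.filter fun φ => Satisfiable φ with hZ
  have hzero : ∀ φ ∉ Z, numSolutions φ = 0 := by
    intro φ hφ
    by_contra h
    exact hφ (by simpa [hZ] using (satisfiable_iff_numSolutions φ).2 (Nat.pos_of_ne_zero h))
  have hCS := sq_sum_le_card_mul_sum_sq (s := Z) (f := fun φ => (numSolutions φ : ℝ))
  have e1 : ∑ φ ∈ Z, (numSolutions φ : ℝ) = ∑ φ, (numSolutions φ : ℝ) :=
    Finset.sum_subset (Finset.subset_univ _) fun φ _ h => by simp [hzero φ h]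
  have e2 : ∑ φ ∈ Z, (numSolutions φ : ℝ) ^ 2 = ∑ φ, (numSolutions φ : ℝ) ^ 2 :=
    Finset.sum_subset (Finset.subset_univ _) fun φ _ h => by simp [hzero φ h]
  rw [e1, e2, sum_numSolutions hq] at hCS
  have h3 := hCS.trans (mul_le_mul_of_nonneg_left hB (by positivity))
  rw [prSat_eq]
  have hK : 0 < ((d : ℝ) ^ n) ^ 2 * (M * u ^ t) ^ 2 := by positivity
  refine le_of_mul_le_mul_right ?_ hK
  have hM' : M ≠ 0 := hM.ne'
  calc 1 * (((d : ℝ) ^ n) ^ 2 * (M * u ^ t) ^ 2) = (d ^ n * (M * u ^ t)) ^ 2 := by ring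
    _ ≤ _ := h3
    _ = (Z.card / M * B) * (((d : ℝ) ^ n) ^ 2 * (M * u ^ t) ^ 2) := by
        field_simp
        ring

/-! ### Averaging over pairs by their agreement set -/

theorem card_agree_superset {n d : ℕ} (σ : Fin n → Fin d) (A : Finset (Fin n)) :
    (Finset.univ.filter fun τ : Fin n → Fin d => ∀ i ∈ A, σ i = τ i).card = d ^ (n - A.card) := by
  classical
  have : (Finset.univ.filter fun τ : Fin n → Fin d => ∀ i ∈ A, σ i = τ i)
      = Fintype.piFinset fun i => if i ∈ A then {σ i} else Finset.univ := by
    ext τ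
    simp only [Finset.mem_filter, Finset.mem_univ, true_and, Fintype.mem_piFinset]
    refine forall_congr' fun i => ?_
    split_ifs with h <;> simp [h, eq_comm]
  rw [this, Fintype.card_piFinset]
  have h2 : ∀ i, (if i ∈ A then ({σ i} : Finset (Fin d)) else Finset.univ).card
      = if i ∈ A then 1 else d := by
    intro i
    split_ifs <;> simp
  rw [Finset.prod_congr rfl fun i _ => h2 i, Finset.prod_ite]
  simp only [Finset.prod_const_one, one_mul, Finset.prod_const]
  congr 1
  rw [← Finset.compl_filter, Finset.card_compl]
  simp

/-- A union bound for the overlaps of weight above c: exact agreement on A is relaxed to agreement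
on at least A, which d^(n-S) assignments achieve for each of the C(n,S) sets A. -/
theorem sum_agreement_le {n d : ℕ} (hd : 0 < d) (w : ℕ → ℝ) (hw : ∀ S, 0 ≤ w S) (c ρ : ℝ)
    (hc : 0 ≤ c) (hρ : 0 ≤ ρ)
    (h : ∀ S ≤ n, w S ≤ c ∨ (1 ≤ S ∧ n.choose S * w S / d ^ S ≤ ρ ^ S)) (σ : Fin n → Fin d) :
    ∑ τ : Fin n → Fin d, w (Finset.univ.filter fun i => σ i = τ i).card
      ≤ d ^ n * (c + ∑ S ∈ Finset.Icc 1 n, ρ ^ S) := by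
  classical
  set P : Finset ℕ := (Finset.range (n + 1)).filter fun S => ¬ w S ≤ c with hP
  have h1 : ∀ τ : Fin n → Fin d, w (Finset.univ.filter fun i => σ i = τ i).card
      ≤ c + ∑ S ∈ P, ∑ A ∈ (Finset.univ : Finset (Fin n)).powersetCard S,
        if (∀ i ∈ A, σ i = τ i) then w S else 0 := by
    intro τ
    set A := Finset.univ.filter fun i => σ i = τ i with hA
    have hAn : A.card ≤ n := by simpa using Finset.card_le_univ A
    have hin : ∀ S ∈ P, ∀ A ∈ (Finset.univ : Finset (Fin n)).powersetCard S,
        0 ≤ if (∀ i ∈ A, σ i = τ i) then w S else 0 := by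
      intro S _ A _
      split_ifs
      · exact hw S
      · exact le_rfl
    by_cases hwc : w A.card ≤ c
    · exact hwc.trans (le_add_of_nonneg_right
        (Finset.sum_nonneg fun S hS => Finset.sum_nonneg (hin S hS)))
    · have hAP : A.card ∈ P := by
        simp only [hP, Finset.mem_filter, Finset.mem_range]
        exact ⟨by omega, hwc⟩
      refine le_add_of_nonneg_of_le hc ?_
      refine le_trans ?_ (Finset.single_le_sum
        (fun S hS => Finset.sum_nonneg (hin S hS)) hAP)
      refine le_trans ?_ (Finset.single_le_sum (hin _ hAP)
        (Finset.mem_powersetCard.2 ⟨Finset.subset_univ A, rfl⟩))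
      rw [if_pos]
      intro i hi
      simpa [hA] using hi
  refine (Finset.sum_le_sum fun τ _ => h1 τ).trans ?_
  rw [Finset.sum_add_distrib, Finset.sum_comm, mul_add]
  refine add_le_add (by simp) ?_
  have hPs : P ⊆ Finset.Icc 1 n := by
    intro S hS
    simp only [hP, Finset.mem_filter, Finset.mem_range] at hS
    rcases h S (by omega) with h' | h'
    · exact absurd h' hS.2
    · exact Finset.mem_Icc.2 ⟨h'.1, by omega⟩
  rw [Finset.mul_sum]
  refine le_trans ?_ (Finset.sum_le_sum_of_subset_of_nonneg hPs
    fun S _ _ => by positivity)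
  refine Finset.sum_le_sum fun S hS => ?_
  simp only [hP, Finset.mem_filter, Finset.mem_range] at hS
  have hSn : S ≤ n := by omega
  have hb : n.choose S * w S / d ^ S ≤ ρ ^ S := by
    rcases h S hSn with h' | h'
    · exact absurd h' hS.2
    · exact h'.2
  rw [Finset.sum_comm]
  have h3 : ∀ A ∈ (Finset.univ : Finset (Fin n)).powersetCard S,
      (∑ τ : Fin n → Fin d, if (∀ i ∈ A, σ i = τ i) then w S else 0) = d ^ (n - S) * w S := by
    intro A hA
    rw [← Finset.sum_filter, Finset.sum_const, card_agree_superset,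
      (Finset.mem_powersetCard.1 hA).2]
    simp
  rw [Finset.sum_congr rfl h3, Finset.sum_const, Finset.card_powersetCard]
  simp only [Finset.card_univ, Fintype.card_fin, nsmul_eq_mul]
  calc (n.choose S : ℝ) * (d ^ (n - S) * w S)
      = d ^ n * (n.choose S * w S / d ^ S) := by
        rw [← Nat.sub_add_cancel hSn, pow_add, Nat.add_sub_cancel]
        field_simp
    _ ≤ d ^ n * ρ ^ S := by gcongr

/-- Second moment bound for the probability of satisfiability. -/
theorem one_le_prSat_mul {n k d q t : ℕ} (hn : k ≤ n) (hn0 : 0 < n) (hd : 0 < d) (hq : q < d ^ k)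
    (c ρ : ℝ) (hc : 0 ≤ c) (hρ : 0 ≤ ρ)
    (h : ∀ S ≤ n,
      (1 + (q / (d ^ k : ℕ)) / (1 - q / (d ^ k : ℕ)) * ((S : ℝ) / n) ^ k) ^ t ≤ c ∨
      (1 ≤ S ∧ n.choose S *
        (1 + (q / (d ^ k : ℕ)) / (1 - q / (d ^ k : ℕ)) * ((S : ℝ) / n) ^ k) ^ t / d ^ S ≤ ρ ^ S)) :
    1 ≤ prSat n k d q t * (c + ∑ S ∈ Finset.Icc 1 n, ρ ^ S) := by
  have hu : (0 : ℝ) < 1 - q / (d ^ k : ℕ) := by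
    have : (0 : ℝ) < (d ^ k : ℕ) := by positivity
    rw [sub_pos, div_lt_one this]
    exact_mod_cast hq
  apply second_moment hq hn hd
  refine (sum_numSolutions_sq_le hn0 hq).trans ?_
  refine mul_le_mul_of_nonneg_left ?_ (by positivity)
  refine (Finset.sum_le_sum fun σ _ => sum_agreement_le hd
    (fun S => (1 + (q / (d ^ k : ℕ)) / (1 - q / (d ^ k : ℕ)) * ((S : ℝ) / n) ^ k) ^ t)
    (fun S => by positivity) c ρ hc hρ h σ).trans ?_
  simp


/-! ### Estimates for a single overlap -/

/-- The function x ↦ ln(1+βx^(j+1)) is convex on [0,1] when β ≤ j, so it lies below its chord. With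
j = k-1 this condition is k ≥ 1/(1-p). -/
theorem log_one_add_mul_pow_le {β : ℝ} {j : ℕ} (hβ0 : 0 ≤ β) (hβ : β ≤ j) {x : ℝ}
    (hx0 : 0 ≤ x) (hx1 : x ≤ 1) :
    Real.log (1 + β * x ^ (j + 1)) ≤ x * Real.log (1 + β) := by
  set h : ℝ → ℝ := fun y => Real.log (1 + β * y ^ (j + 1)) with hh
  have hpos : ∀ y : ℝ, 0 ≤ y → 0 < 1 + β * y ^ (j + 1) := fun y hy => by positivity
  have hder : ∀ y : ℝ, 0 ≤ y →
      HasDerivAt h (β * ((j + 1) * y ^ j) / (1 + β * y ^ (j + 1))) y := by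
    intro y hy
    have h1 := (((hasDerivAt_pow (j + 1) y).const_mul β).const_add 1).log (hpos y hy).ne'
    simpa using h1
  have hconv : ConvexOn ℝ (Set.Icc 0 1) h := by
    refine MonotoneOn.convexOn_of_deriv (convex_Icc 0 1)
      (fun y hy => (hder y hy.1).continuousAt.continuousWithinAt)
      (fun y hy => (hder y (interior_subset hy).1).differentiableAt.differentiableWithinAt) ?_
    intro y hy z hz hyz
    rw [interior_Icc] at hy hz
    rw [(hder y hy.1.le).deriv, (hder z hz.1.le).deriv,
      div_le_div_iff₀ (hpos y hy.1.le) (hpos z hz.1.le)]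
    -- Monotonicity of the derivative, cross-multiplied and with β(j+1) removed. Each term of the
    -- geometric sum for (z^j - y^j)/(z-y) is at least y^j z^j.
    have key : β * (y ^ j * z ^ j) * (z - y) ≤ z ^ j - y ^ j := by
      rw [← Commute.geom_sum₂_mul (Commute.all z y) j]
      have hzy : 0 ≤ z - y := sub_nonneg.2 hyz
      refine mul_le_mul_of_nonneg_right ?_ hzy
      calc β * (y ^ j * z ^ j) ≤ j * (y ^ j * z ^ j) := by
            have : 0 ≤ y ^ j * z ^ j := by have := hy.1.le; have := hz.1.le; positivity
            exact mul_le_mul_of_nonneg_right hβ this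
        _ = ∑ i ∈ Finset.range j, y ^ j * z ^ j := by simp
        _ ≤ ∑ i ∈ Finset.range j, z ^ i * y ^ (j - 1 - i) := by
            refine Finset.sum_le_sum fun i hi => ?_
            have hi' := Finset.mem_range.1 hi
            rw [mul_comm]
            exact mul_le_mul (pow_le_pow_of_le_one hz.1.le hz.2.le hi'.le)
              (pow_le_pow_of_le_one hy.1.le hy.2.le (by omega)) (pow_nonneg hy.1.le _)
              (pow_nonneg hz.1.le _)
    have hc : 0 ≤ β * ((j : ℝ) + 1) := by positivity
    have := mul_le_mul_of_nonneg_left key hc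
    rw [pow_succ, pow_succ]
    nlinarith [this]
  have := hconv.2 (x := 0) (y := 1) (by simp) (by simp) (sub_nonneg.2 hx1) hx0 (by ring)
  simpa [hh] using this

theorem choose_div_pow_le {n S d : ℕ} (hS : 1 ≤ S) (hd : 0 < d) :
    (n.choose S : ℝ) / d ^ S ≤ (Real.exp 1 * n / (S * d)) ^ S := by
  have hS0 : (0 : ℝ) < S := by exact_mod_cast hS
  have hd0 : (0 : ℝ) < d := by exact_mod_cast hd
  have h1 : (n.choose S : ℝ) ≤ (n : ℝ) ^ S / S.factorial := Nat.choose_le_pow_div S n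
  have h2 : (S : ℝ) ^ S / S.factorial ≤ Real.exp S := Real.pow_div_factorial_le_exp S hS0.le S
  have hf : (0 : ℝ) < S.factorial := by exact_mod_cast Nat.factorial_pos S
  rw [div_le_iff₀ (by positivity)]
  refine h1.trans ?_
  rw [div_le_iff₀ hf] at h2 ⊢
  rw [div_pow, mul_pow, mul_pow, ← Real.exp_nat_mul, mul_one]
  have e : Real.exp S * (n : ℝ) ^ S / ((S : ℝ) ^ S * d ^ S) * d ^ S * S.factorial
      = (n : ℝ) ^ S * ((Real.exp S * S.factorial) / (S : ℝ) ^ S) := by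
    field_simp
  rw [e]
  refine le_mul_of_one_le_right (by positivity) ?_
  rwa [one_le_div (by positivity)]

theorem one_add_pow_le_exp {y : ℝ} (hy : 0 ≤ y) (t : ℕ) :
    (1 + y) ^ t ≤ Real.exp (t * y) := by
  rw [Real.exp_nat_mul]
  refine pow_le_pow_left₀ (by positivity) ?_ t
  linarith [Real.add_one_le_exp y]

/-- Here γ cuts off the negligible overlaps, x₀ separates small from large ones, and n^(ηS) and
n^(aS) bound the weight in these two ranges. -/
theorem agreement_term_bound {n d t k S : ℕ} {α γ η a b K x₀ δ : ℝ} (hn : 1 ≤ n) (hS : S ≤ n)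
    (hk : 2 ≤ k) (hd : (n : ℝ) ^ α / 2 ≤ d) (hb : 0 ≤ b) (hK : 0 ≤ K)
    (htb : t * b ≤ K * (n * Real.log n))
    (hlog : ∀ x : ℝ, 0 ≤ x → x ≤ 1 → t * Real.log (1 + b * x ^ k) ≤ a * x * (n * Real.log n))
    (hx₀ : 0 < x₀) (hKη : K * x₀ ≤ η) (hδ1 : γ + η - α ≤ -δ) (hδ2 : a - α ≤ -δ) :
    (1 + b * ((S : ℝ) / n) ^ k) ^ t ≤ Real.exp (t * (b * ((n : ℝ) ^ (-γ)) ^ k)) ∨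
    (1 ≤ S ∧ n.choose S * (1 + b * ((S : ℝ) / n) ^ k) ^ t / d ^ S
      ≤ ((2 * Real.exp 1 + 2 * Real.exp 1 / x₀) * (n : ℝ) ^ (-δ)) ^ S) := by
  have hn0 : (0 : ℝ) < n := by exact_mod_cast hn
  have hn1 : (1 : ℝ) ≤ n := by exact_mod_cast hn
  have hl : 0 ≤ Real.log n := Real.log_nonneg hn1
  set x : ℝ := (S : ℝ) / n with hx
  have hSx : (S : ℝ) = n * x := by rw [hx]; field_simp
  have hx0 : 0 ≤ x := by positivity
  have hx1 : x ≤ 1 := by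
    rw [hx, div_le_one hn0]
    exact_mod_cast hS
  have hw := one_add_pow_le_exp (y := b * x ^ k) (by positivity) t
  rcases le_or_gt x ((n : ℝ) ^ (-γ)) with hsm | hbig
  · left
    refine hw.trans (Real.exp_le_exp.2 ?_)
    gcongr
  right
  have hxpos : 0 < x := (Real.rpow_pos_of_pos hn0 _).trans hbig
  have hS1 : 1 ≤ S := by
    rcases Nat.eq_zero_or_pos S with h | h
    · simp [hx, h] at hxpos
    · exact h
  refine ⟨hS1, ?_⟩
  have hpα : 0 < (n : ℝ) ^ α := Real.rpow_pos_of_pos hn0 _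
  have hd0 : (0 : ℝ) < d := lt_of_lt_of_le (by positivity) hd
  have hdn : 0 < d := by exact_mod_cast hd0
  -- It suffices to bound the weight by W^S and compare S-th roots.
  have reduce : ∀ W : ℝ, 0 ≤ W → (1 + b * x ^ k) ^ t ≤ W ^ S →
      Real.exp 1 / (x * d) * W ≤ (2 * Real.exp 1 + 2 * Real.exp 1 / x₀) * (n : ℝ) ^ (-δ) →
      n.choose S * (1 + b * x ^ k) ^ t / d ^ S
        ≤ ((2 * Real.exp 1 + 2 * Real.exp 1 / x₀) * (n : ℝ) ^ (-δ)) ^ S := by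
    intro W hW h1 h2
    calc n.choose S * (1 + b * x ^ k) ^ t / d ^ S
        = n.choose S / d ^ S * (1 + b * x ^ k) ^ t := by ring
      _ ≤ (Real.exp 1 * n / (S * d)) ^ S * W ^ S := by
          gcongr
          exact choose_div_pow_le hS1 hdn
      _ = (Real.exp 1 / (x * d) * W) ^ S := by
          rw [← mul_pow, hSx]
          congr 2
          field_simp
      _ ≤ _ := pow_le_pow_left₀ (by positivity) h2 S
  have hexp : ∀ c : ℝ, ((n : ℝ) ^ c) ^ S = Real.exp (c * x * (n * Real.log n)) := by
    intro c
    rw [Real.rpow_def_of_pos hn0, ← Real.exp_nat_mul, hSx]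
    ring_nf
  have hnδ : 0 ≤ (n : ℝ) ^ (-δ) := by positivity
  rcases le_or_gt x x₀ with hxx | hxx
  · refine reduce ((n : ℝ) ^ η) (by positivity) ?_ ?_
    · rw [hexp]
      refine hw.trans (Real.exp_le_exp.2 ?_)
      have hxk : x ^ k ≤ x₀ * x := by
        calc x ^ k ≤ x ^ 2 := pow_le_pow_of_le_one hx0 hx1 hk
          _ = x * x := sq x
          _ ≤ x₀ * x := by gcongr
      calc t * (b * x ^ k) = t * b * x ^ k := by ring
        _ ≤ K * (n * Real.log n) * (x₀ * x) := by gcongr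
        _ = K * x₀ * x * (n * Real.log n) := by ring
        _ ≤ η * x * (n * Real.log n) := by gcongr
    · have h1 : Real.exp 1 / (x * d) ≤ Real.exp 1 / ((n : ℝ) ^ (-γ) * ((n : ℝ) ^ α / 2)) := by
        gcongr
      calc Real.exp 1 / (x * d) * (n : ℝ) ^ η
          ≤ Real.exp 1 / ((n : ℝ) ^ (-γ) * ((n : ℝ) ^ α / 2)) * (n : ℝ) ^ η := by gcongr
        _ = 2 * Real.exp 1 * (n : ℝ) ^ (γ + η - α) := by
            rw [Real.rpow_sub hn0, Real.rpow_add hn0, Real.rpow_neg hn0.le]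
            have : 0 < (n : ℝ) ^ γ := Real.rpow_pos_of_pos hn0 _
            field_simp
        _ ≤ 2 * Real.exp 1 * (n : ℝ) ^ (-δ) := by
            gcongr
        _ ≤ _ := by
            gcongr
            exact le_add_of_nonneg_right (by positivity)
  · refine reduce ((n : ℝ) ^ a) (by positivity) ?_ ?_
    · rw [hexp]
      have hp : 0 < 1 + b * x ^ k := by positivity
      rw [← Real.exp_log hp, ← Real.exp_nat_mul]
      exact Real.exp_le_exp.2 (hlog x hx0 hx1)
    · have h1 : Real.exp 1 / (x * d) ≤ Real.exp 1 / (x₀ * ((n : ℝ) ^ α / 2)) := by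
        gcongr
      calc Real.exp 1 / (x * d) * (n : ℝ) ^ a
          ≤ Real.exp 1 / (x₀ * ((n : ℝ) ^ α / 2)) * (n : ℝ) ^ a := by gcongr
        _ = 2 * Real.exp 1 / x₀ * (n : ℝ) ^ (a - α) := by
            rw [Real.rpow_sub hn0]
            field_simp
        _ ≤ 2 * Real.exp 1 / x₀ * (n : ℝ) ^ (-δ) := by
            gcongr
        _ ≤ _ := by
            gcongr
            exact le_add_of_nonneg_left (by positivity)

/-- Transfers the chord bound from β to b: when β = k-1, the finite-n value b may exceed k-1, where
convexity fails. -/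
theorem log_one_add_mul_le {β b y : ℝ} (hβ : 0 ≤ β) (hb : 0 ≤ b) (hy : 0 ≤ y) :
    Real.log (1 + b * y) ≤ Real.log (1 + β * y) + |b - β| * y := by
  have h1 : 0 < 1 + β * y := by positivity
  have h2 : 1 + b * y ≤ (1 + β * y) * (1 + |b - β| * y) := by
    have := mul_le_mul_of_nonneg_right (le_abs_self (b - β)) hy
    have : 0 ≤ β * y * (|b - β| * y) := by positivity
    nlinarith
  have h3 : 0 < 1 + |b - β| * y := by positivity
  calc Real.log (1 + b * y) ≤ Real.log ((1 + β * y) * (1 + |b - β| * y)) :=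
        Real.log_le_log (by positivity) h2
    _ = Real.log (1 + β * y) + Real.log (1 + |b - β| * y) := Real.log_mul h1.ne' h3.ne'
    _ ≤ _ := by
        have := Real.log_le_sub_one_of_pos h3
        linarith

theorem log_one_add_mul_pow_le_add {β b : ℝ} {k : ℕ} (hk : 1 ≤ k) (hβ0 : 0 ≤ β)
    (hβ : β ≤ (k : ℝ) - 1) (hb : 0 ≤ b) {x : ℝ} (hx0 : 0 ≤ x) (hx1 : x ≤ 1) :
    Real.log (1 + b * x ^ k) ≤ x * (Real.log (1 + β) + |b - β|) := by
  obtain ⟨j, rfl⟩ : ∃ j, k = j + 1 := ⟨k - 1, by omega⟩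
  have h1 := log_one_add_mul_le hβ0 hb (y := x ^ (j + 1)) (by positivity)
  have h2 := log_one_add_mul_pow_le (j := j) hβ0 (by push_cast at hβ; linarith) hx0 hx1
  have h3 : x ^ (j + 1) ≤ x := pow_le_of_le_one hx0 hx1 (by omega)
  have h4 := mul_le_mul_of_nonneg_left h3 (abs_nonneg (b - β))
  linarith

/-! ### Rounded parameters and the two limits -/

section Asymptotics

variable {k : ℕ} {α p r : ℝ} {d q t : ℕ → ℕ}

theorem tendsto_of_abs_sub_lt_one {u v : ℕ → ℝ} (h : ∀ᶠ n in atTop, |u n - v n| < 1)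
    {c : ℝ} {w : ℕ → ℝ} (hw : Tendsto w atTop atTop)
    (hv : ∀ᶠ n in atTop, v n = c * w n) :
    Tendsto (fun n => u n / w n) atTop (𝓝 c) := by
  have h0 : Tendsto (fun n => (w n)⁻¹) atTop (𝓝 0) := tendsto_inv_atTop_zero.comp hw
  rw [tendsto_iff_norm_sub_tendsto_zero]
  refine squeeze_zero' (Eventually.of_forall fun n => norm_nonneg _) ?_ h0
  filter_upwards [h, hv, hw.eventually_gt_atTop 0] with n h1 h2 h3
  have : u n / w n - c = (u n - v n) / w n := by
    rw [h2]
    field_simp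
  rw [this, Real.norm_eq_abs, abs_div, abs_of_pos h3, div_eq_mul_inv]
  exact mul_le_of_le_one_left (by positivity) h1.le

theorem tendsto_domain_ratio (hα : 0 < α)
    (hd : ∀ᶠ n : ℕ in atTop, |(d n : ℝ) - (n : ℝ) ^ α| < 1) :
    Tendsto (fun n : ℕ => (d n : ℝ) / (n : ℝ) ^ α) atTop (𝓝 1) :=
  tendsto_of_abs_sub_lt_one hd ((tendsto_rpow_atTop hα).comp tendsto_natCast_atTop_atTop)
    (Eventually.of_forall fun n => by simp)

theorem tendsto_domain_atTop (hα : 0 < α)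
    (hd : ∀ᶠ n : ℕ in atTop, |(d n : ℝ) - (n : ℝ) ^ α| < 1) :
    Tendsto (fun n : ℕ => (d n : ℝ)) atTop atTop := by
  have h1 : Tendsto (fun n : ℕ => (n : ℝ) ^ α) atTop atTop :=
    (tendsto_rpow_atTop hα).comp tendsto_natCast_atTop_atTop
  refine tendsto_atTop_mono' _ ?_ (tendsto_atTop_add_const_right _ (-1) h1)
  filter_upwards [hd] with n hn
  linarith [(abs_lt.1 hn).1]

theorem tendsto_tightness (hk : k ≠ 0) (hd : Tendsto (fun n : ℕ => (d n : ℝ)) atTop atTop)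
    (hq : ∀ᶠ n : ℕ in atTop, |(q n : ℝ) - p * (d n : ℝ) ^ k| < 1) :
    Tendsto (fun n : ℕ => (q n : ℝ) / (d n ^ k : ℕ)) atTop (𝓝 p) := by
  simp only [Nat.cast_pow]
  exact tendsto_of_abs_sub_lt_one hq ((tendsto_pow_atTop hk).comp hd)
    (Eventually.of_forall fun n => rfl)

theorem tendsto_mul_log_atTop :
    Tendsto (fun n : ℕ => (n : ℝ) * Real.log n) atTop atTop :=
  tendsto_natCast_atTop_atTop.atTop_mul_atTop₀
    (Real.tendsto_log_atTop.comp tendsto_natCast_atTop_atTop)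

theorem tendsto_log_domain_div_log (hα : 0 < α)
    (hd : ∀ᶠ n : ℕ in atTop, |(d n : ℝ) - (n : ℝ) ^ α| < 1) :
    Tendsto (fun n : ℕ => Real.log (d n) / Real.log n) atTop (𝓝 α) := by
  have h1 := (tendsto_domain_ratio hα hd).log one_ne_zero
  have hl : Tendsto (fun n : ℕ => Real.log n) atTop atTop :=
    Real.tendsto_log_atTop.comp tendsto_natCast_atTop_atTop
  have h2 := (h1.div_atTop hl).add_const α
  rw [zero_add] at h2
  refine h2.congr' ?_
  filter_upwards [hl.eventually_gt_atTop 0, eventually_gt_atTop 0,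
    (tendsto_domain_atTop hα hd).eventually_gt_atTop 0] with n h3 h4 h5
  have hn0 : (0 : ℝ) < n := by exact_mod_cast h4
  rw [Real.log_div h5.ne' (Real.rpow_pos_of_pos hn0 α).ne', Real.log_rpow hn0]
  field_simp
  ring

theorem tightness_lt_one_iff {d q k : ℕ} (hd : 0 < d) :
    (q : ℝ) / (d ^ k : ℕ) < 1 ↔ q < d ^ k := by
  have : (0 : ℝ) < (d ^ k : ℕ) := by positivity
  rw [div_lt_one this, Nat.cast_lt]

theorem tendsto_prSat_zero (hk : k ≠ 0) (hα : 0 < α) (hp1 : p < 1)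
    (hd : ∀ᶠ n : ℕ in atTop, |(d n : ℝ) - (n : ℝ) ^ α| < 1)
    (hq : ∀ᶠ n : ℕ in atTop, |(q n : ℝ) - p * (d n : ℝ) ^ k| < 1)
    (ht : ∀ᶠ n : ℕ in atTop, |(t n : ℝ) - r * (n : ℝ) * Real.log (n : ℝ)| < 1)
    (hr : α + r * Real.log (1 - p) < 0) :
    Tendsto (fun n : ℕ => prSat n k (d n) (q n) (t n)) atTop (𝓝 0) := by
  have hdT := tendsto_domain_atTop hα hd
  have hv := tendsto_tightness hk hdT hq
  have hT := tendsto_of_abs_sub_lt_one ht tendsto_mul_log_atTop (c := r)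
    (Eventually.of_forall fun n => by ring)
  have hlog := (hv.const_sub 1).log (sub_pos.2 hp1).ne'
  have hlim := (tendsto_mul_log_atTop.atTop_mul_neg hr
    ((tendsto_log_domain_div_log hα hd).add (hT.mul hlog)))
  have hE := Real.tendsto_exp_atBot.comp hlim
  refine squeeze_zero' (Eventually.of_forall fun n => prSat_nonneg _ _ _ _ _) ?_ hE
  filter_upwards [hdT.eventually_gt_atTop 0, hv.eventually_lt_const hp1, eventually_ge_atTop k,
    tendsto_mul_log_atTop.eventually_gt_atTop 0] with n h1 h2 h3 h4
  have hdn : 0 < d n := by exact_mod_cast h1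
  refine (prSat_le_first_moment h3 ((tightness_lt_one_iff hdn).1 h2)).trans (le_of_eq ?_)
  have hu : 0 < 1 - (q n : ℝ) / (d n ^ k : ℕ) := sub_pos.2 h2
  have hn0 : (n : ℝ) ≠ 0 := left_ne_zero_of_mul h4.ne'
  have hl0 : Real.log n ≠ 0 := right_ne_zero_of_mul h4.ne'
  calc (d n : ℝ) ^ n * (1 - (q n : ℝ) / (d n ^ k : ℕ)) ^ t n
      = Real.exp (n * Real.log (d n) + t n * Real.log (1 - (q n : ℝ) / (d n ^ k : ℕ))) := by
        rw [Real.exp_add, Real.exp_nat_mul, Real.exp_nat_mul, Real.exp_log h1, Real.exp_log hu]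
    _ = _ := by
        simp only [Function.comp]
        congr 1
        field_simp

theorem tendsto_prSat_one (hk : 2 ≤ k) (hα : 1 / (k : ℝ) < α) (hp0 : 0 < p) (hp1 : p < 1)
    (hkp : 1 / (1 - p) ≤ (k : ℝ)) (hr0 : 0 ≤ r)
    (hd : ∀ᶠ n : ℕ in atTop, |(d n : ℝ) - (n : ℝ) ^ α| < 1)
    (hq : ∀ᶠ n : ℕ in atTop, |(q n : ℝ) - p * (d n : ℝ) ^ k| < 1)
    (ht : ∀ᶠ n : ℕ in atTop, |(t n : ℝ) - r * (n : ℝ) * Real.log (n : ℝ)| < 1)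
    (hr : 0 < α + r * Real.log (1 - p)) :
    Tendsto (fun n : ℕ => prSat n k (d n) (q n) (t n)) atTop (𝓝 1) := by
  have hk0 : (0 : ℝ) < k := by exact_mod_cast (by omega : 0 < k)
  have hα0 : 0 < α := (by positivity : (0 : ℝ) < 1 / k).trans hα
  have hp' : 0 < 1 - p := sub_pos.2 hp1
  have hdT := tendsto_domain_atTop hα0 hd
  have hv := tendsto_tightness (by omega) hdT hq
  have hT := tendsto_of_abs_sub_lt_one ht tendsto_mul_log_atTop (c := r)
    (Eventually.of_forall fun n => by ring)
  -- γ > 1/k gives c → 1; γ < α leaves room for the entropy factor.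
  obtain ⟨γ, hγ1, hγ2⟩ := exists_between hα
  set β : ℝ := p / (1 - p) with hβ
  have hβ0 : 0 ≤ β := by positivity
  have h1β : 1 + β = (1 - p)⁻¹ := by
    rw [hβ]
    field_simp
    ring
  have hβk : β ≤ (k : ℝ) - 1 := by
    rw [one_div, ← h1β] at hkp
    linarith
  have hL : Real.log (1 + β) = -Real.log (1 - p) := by rw [h1β, Real.log_inv]
  set b : ℕ → ℝ := fun n => ((q n : ℝ) / (d n ^ k : ℕ)) / (1 - (q n : ℝ) / (d n ^ k : ℕ)) with hb
  have hbT : Tendsto b atTop (𝓝 β) := hv.div (hv.const_sub 1) hp'.ne'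
  -- The gap below α absorbs the errors of t/(n ln n) → r and b → β.
  obtain ⟨a, ha1, ha2⟩ := exists_between
    (by rw [hL]; linarith : r * Real.log (1 + β) < α)
  set η : ℝ := (α - γ) / 2 with hη
  have hη0 : 0 < η := by rw [hη]; linarith
  -- Eventually bounds tb/(n ln n); then x₀ = η/K makes Kx₀ = η.
  set K : ℝ := (r + 1) * (β + 1) with hKdef
  have hK : 0 < K := by positivity
  set δ : ℝ := min η (α - a) with hδ
  have hδ0 : 0 < δ := lt_min hη0 (sub_pos.2 ha2)
  set C : ℝ := 2 * Real.exp 1 + 2 * Real.exp 1 / (η / K) with hC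
  set c : ℕ → ℝ := fun n => Real.exp (t n * (b n * ((n : ℝ) ^ (-γ)) ^ k)) with hc
  set ρ : ℕ → ℝ := fun n => C * (n : ℝ) ^ (-δ) with hρ
  have hρT : Tendsto ρ atTop (𝓝 0) := by
    have := ((tendsto_rpow_neg_atTop hδ0).comp tendsto_natCast_atTop_atTop).const_mul C
    simpa using this
  have hcT : Tendsto c atTop (𝓝 1) := by
    have hγk : 0 < γ * k - 1 := by
      rw [div_lt_iff₀ hk0] at hγ1
      linarith
    -- The exponent of c is of order ln n / n^(γk-1).
    have h1 : Tendsto (fun n : ℕ => Real.log n / (n : ℝ) ^ (γ * k - 1)) atTop (𝓝 0) :=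
      (isLittleO_log_rpow_atTop hγk).tendsto_div_nhds_zero.comp tendsto_natCast_atTop_atTop
    have h2 := (hT.mul hbT).mul h1
    rw [mul_zero] at h2
    have h3 := (Real.continuous_exp.tendsto 0).comp h2
    rw [Real.exp_zero] at h3
    refine h3.congr' ?_
    filter_upwards [tendsto_mul_log_atTop.eventually_gt_atTop 0, eventually_gt_atTop 0] with n h4 h5
    have hn0 : (0 : ℝ) < n := by exact_mod_cast h5
    have hl0 : Real.log n ≠ 0 := right_ne_zero_of_mul h4.ne'
    simp only [Function.comp, hc]
    congr 1
    rw [← Real.rpow_natCast, ← Real.rpow_mul hn0.le, neg_mul, Real.rpow_neg hn0.le,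
      Real.rpow_sub hn0, Real.rpow_one]
    have : 0 < (n : ℝ) ^ (γ * k) := Real.rpow_pos_of_pos hn0 _
    field_simp
  have hslope : ∀ᶠ n : ℕ in atTop,
      (t n : ℝ) / (n * Real.log n) * (Real.log (1 + β) + |b n - β|) < a := by
    have h1 : Tendsto (fun n => |b n - β|) atTop (𝓝 0) := by
      simpa using (hbT.sub_const β).abs
    have h2 := hT.mul (h1.const_add (Real.log (1 + β)))
    rw [add_zero] at h2
    exact h2.eventually_lt_const ha1
  have hmain : ∀ᶠ n : ℕ in atTop, 1 ≤ prSat n k (d n) (q n) (t n) * (c n + 2 * ρ n) := by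
    filter_upwards [hdT.eventually_gt_atTop 0, hv.eventually_lt_const hp1, eventually_ge_atTop k,
      tendsto_mul_log_atTop.eventually_gt_atTop 0, hslope,
      hT.eventually_lt_const (lt_add_one r), hbT.eventually_lt_const (lt_add_one β),
      (tendsto_domain_ratio hα0 hd).eventually_const_lt (by norm_num : (1 / 2 : ℝ) < 1),
      hρT.eventually_lt_const (by norm_num : (0 : ℝ) < 1 / 2)]
      with n h1 h2 h3 h4 h5 h6 h7 h8 h9
    have hdn : 0 < d n := by exact_mod_cast h1
    have hqn := (tightness_lt_one_iff hdn).1 h2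
    have hn : 1 ≤ n := by omega
    have hn0 : (0 : ℝ) < n := by exact_mod_cast hn
    have hu : 0 < 1 - (q n : ℝ) / (d n ^ k : ℕ) := sub_pos.2 h2
    have hb0 : 0 ≤ b n := by positivity
    have hρ0 : 0 ≤ ρ n := by positivity
    rw [div_lt_iff₀ h4] at h6
    have hbase := one_le_prSat_mul h3 hn hdn hqn (t := t n) (c n) (ρ n) (Real.exp_pos _).le hρ0
      fun S hS => agreement_term_bound (α := α) (γ := γ) (η := η) (a := a) (b := b n) (K := K)
        (x₀ := η / K) (δ := δ) hn hS hk
        (by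
          rw [lt_div_iff₀ (Real.rpow_pos_of_pos hn0 α)] at h8
          linarith)
        hb0 hK.le
        (by
          calc (t n : ℝ) * b n ≤ ((r + 1) * (n * Real.log n)) * (β + 1) := by gcongr
            _ = K * (n * Real.log n) := by rw [hKdef]; ring)
        (fun x hx0 hx1 => by
          have := log_one_add_mul_pow_le_add (by omega) hβ0 hβk hb0 hx0 hx1
          calc (t n : ℝ) * Real.log (1 + b n * x ^ k)
              ≤ t n * (x * (Real.log (1 + β) + |b n - β|)) := by gcongr
            _ = (t n / (n * Real.log n) * (Real.log (1 + β) + |b n - β|)) *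
                  (x * (n * Real.log n)) := by
                have h4' := h4.ne'
                generalize (n : ℝ) * Real.log n = z at *
                field_simp
            _ ≤ a * (x * (n * Real.log n)) := by gcongr
            _ = _ := by ring)
        (by positivity) (le_of_eq (by field_simp))
        (by
          have := min_le_left η (α - a)
          rw [← hδ] at this
          linarith)
        (by
          have := min_le_right η (α - a)
          rw [← hδ] at this
          linarith)
    refine hbase.trans (mul_le_mul_of_nonneg_left ?_ (prSat_nonneg _ _ _ _ _))
    gcongr
    -- The tail is at most ρ/(1-ρ) ≤ 2ρ, since ρ < 1/2.
    have := geom_sum_Ico_le_of_lt_one (m := 1) (n := n + 1) hρ0 (by linarith)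
    rw [pow_one] at this
    refine this.trans ?_
    rw [div_le_iff₀ (by linarith)]
    nlinarith
  have hlow : Tendsto (fun n => (c n + 2 * ρ n)⁻¹) atTop (𝓝 1) := by
    have := (hcT.add (hρT.const_mul 2)).inv₀ (by norm_num)
    simpa using this
  refine tendsto_of_tendsto_of_tendsto_of_le_of_le' hlow tendsto_const_nhds ?_
    (Eventually.of_forall fun n => prSat_le_one _ _ _ _ _)
  filter_upwards [hmain] with n hn
  have hpos : 0 < c n + 2 * ρ n := by
    by_contra hneg
    have := mul_nonpos_of_nonneg_of_nonpos (prSat_nonneg n k (d n) (q n) (t n)) (not_lt.1 hneg)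
    linarith
  rwa [inv_le_iff_one_le_mul₀ hpos]

end Asymptotics

end ModelRB

theorem theorem1 (k : ℕ) (α p r : ℝ)
    (hα : 1 / (k : ℝ) < α) (hp0 : 0 < p) (hp1 : p < 1) (hk : 1 / (1 - p) ≤ (k : ℝ)) (hr : 0 ≤ r)
    (d q t : ℕ → ℕ)
    (hd : ∀ᶠ n : ℕ in atTop, |(d n : ℝ) - (n : ℝ) ^ α| < 1)
    (hq : ∀ᶠ n : ℕ in atTop, |(q n : ℝ) - p * (d n : ℝ) ^ k| < 1)
    (ht : ∀ᶠ n : ℕ in atTop, |(t n : ℝ) - r * (n : ℝ) * Real.log (n : ℝ)| < 1) :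
    (r < -(α / Real.log (1 - p)) →
      Tendsto (fun n : ℕ => ModelRB.prSat n k (d n) (q n) (t n)) atTop (𝓝 1)) ∧
    (-(α / Real.log (1 - p)) < r →
      Tendsto (fun n : ℕ => ModelRB.prSat n k (d n) (q n) (t n)) atTop (𝓝 0)) := by
  have hp' : 0 < 1 - p := sub_pos.2 hp1
  have hlog : Real.log (1 - p) < 0 := Real.log_neg hp' (by linarith)
  have hk2 : 2 ≤ k := by
    have h1 : (1 : ℝ) < k := lt_of_lt_of_le (by rw [lt_div_iff₀ hp']; linarith) hk
    exact_mod_cast h1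
  have hk0 : (0 : ℝ) < k := by exact_mod_cast (by omega : 0 < k)
  have hα0 : 0 < α := (by positivity : (0 : ℝ) < 1 / k).trans hα
  constructor
  · intro h
    refine ModelRB.tendsto_prSat_one hk2 hα hp0 hp1 hk hr hd hq ht ?_
    rw [← div_neg, lt_div_iff₀ (neg_pos.2 hlog)] at h
    linarith
  · intro h
    refine ModelRB.tendsto_prSat_zero (by omega) hα0 hp1 hd hq ht ?_
    rw [← div_neg, div_lt_iff₀ (neg_pos.2 hlog)] at h
    linarith
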